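/- Let $\Gamma_{\rm pr}\in\mathbb R^{n\times n}$ and $\Gamma_{\rm obs}\in\mathbb R^{m\times m}$ be symmetric positive definite, let $G\in\mathbb R^{m\times n}$, and let $r\ge 0$ be an integer. Consider the Bayesian linear model $x\sim\mathcal N(0,\Gamma_{\rm pr})$, $y\mid x\sim\mathcal N(Gx,\Gamma_{\rm obs})$. Let $\mu_{\rm pos}(y)=\mathbb E(x\mid y)$ be the posterior mean, $H=G^\top\Gamma_{\rm obs}^{-1}G$, let $\Gamma_{\rm pos}=(H+\Gamma_{\rm pr}^{-1})^{-1}$ be the posterior covariance matrix, and write $\|v\|_{\Gamma_{\rm pos}^{-1}}^2=v^\top\Gamma_{\rm pos}^{-1}v$. Let $(\delta_i^2,\widehat w_i)_{i=1}^n$, with $\delta_i\ge 0$, be generalized eigenpairs of the pencil $(H,\Gamma_{\rm pr}^{-1})$, that is $H\widehat w_i=\delta_i^2\,\Gamma_{\rm pr}^{-1}\widehat w_i$, ordered so that $\delta_i^2\ge\delta_{i+1}^2$ and normalized so that $\widehat w_i^\top\Gamma_{\rm pr}^{-1}\widehat w_j=1$ if $i=j$ and $0$ otherwise. Let $$\widehat\Gamma_{\rm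 pos}=\Gamma_{\rm pr}-\sum_{1\le i\le \min(r,n)}\frac{\delta_i^2}{1+\delta_i^2}\,\widehat w_i\widehat w_i^\top$$ be the optimal approximation of $\Gamma_{\rm pos}$; it lies in the class $\mathcal M_r=\{\Gamma_{\rm pr}-KK^\top\succ0:\operatorname{rank}K\le r\}$. Let $\widehat{\mathcal A}_r=\{(\Gamma_{\rm pr}-B)G^\top\Gamma_{\rm obs}^{-1}: B\in\mathbb R^{n\times n},\ \operatorname{rank}B\le r\}$. Then, with expectations over the joint distribution of $(x,y)$, all of those below being finite: (i) $\widehat A^*=\widehat\Gamma_{\rm pos}G^\top\Gamma_{\rm obs}^{-1}$ belongs to $\widehat{\mathcal A}_r$ and minimizes the Bayes risk $\mathbb E\big(\|Ay-x\|_{\Gamma_{\rm pos}^{-1}}^2\big)$ over $A\in\widehat{\mathcal A}_r$. (ii) The minimum Bayes risk over $\widehat{\mathcal A}_r$ is $$\mathbb E\big(\|\widehat A^*y-x\|_{\Gamma_{\rm pos}^{-1}}^2\big)=\mathbb E\big(\|\widehat A^*y-\mu_{\rm pos}(y)\|_{\Gamma_{\rm pos}^{-1}}^2\big)+\mathbb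 E\big(\|\mu_{\rm pos}(y)-x\|_{\Gamma_{\rm pos}^{-1}}^2\big)=\sum_{i>r}\delta_i^6+\ell,$$ where $\ell=n$ is the dimension of the parameter space. -/

import Mathlib

open MeasureTheory ProbabilityTheory Matrix
open scoped ENNReal

noncomputable section

namespace BayesLinear

variable {n m : ℕ}

/-- The matrix `A` acting on column vectors: `x ↦ A x` on Euclidean spaces. -/
def act {p q : ℕ} (A : Matrix (Fin p) (Fin q) ℝ) (x : EuclideanSpace ℝ (Fin q)) :
    EuclideanSpace ℝ (Fin p) :=
  WithLp.toLp 2 (A *ᵥ x.ofLp)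

theorem measurable_act {p q : ℕ} (A : Matrix (Fin p) (Fin q) ℝ) : Measurable (act A) := by
  have h : Continuous (act A) := by unfold act; fun_prop
  exact h.measurable

/-- `‖v‖_S² = vᵀ S v`. -/
def sqNorm (S : Matrix (Fin n) (Fin n) ℝ) (v : EuclideanSpace ℝ (Fin n)) : ℝ :=
  v.ofLp ⬝ᵥ (S *ᵥ v.ofLp)

/-! ### The Bayesian linear model `x ∼ N(0, Γpr)`, `y ∣ x ∼ N(G x, Γobs)` -/

/-- The prior distribution `N(0, Γpr)` of the parameter `x`. -/
def prior (Γpr : Matrix (Fin n) (Fin n) ℝ) : Measure (EuclideanSpace ℝ (Fin n)) :=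
  multivariateGaussian 0 Γpr

instance (Γpr : Matrix (Fin n) (Fin n) ℝ) : IsProbabilityMeasure (prior Γpr) := by
  unfold prior; infer_instance

open scoped MatrixOrder in
theorem measurable_gaussian_mean (G : Matrix (Fin m) (Fin n) ℝ)
    (Γobs : Matrix (Fin m) (Fin m) ℝ) :
    Measurable (fun x : EuclideanSpace ℝ (Fin n) => multivariateGaussian (act G x) Γobs) := by
  set L := toEuclideanCLM (𝕜 := ℝ) (CFC.sqrt Γobs)
  have hG : Measurable (act G) := measurable_act G
  refine Measure.measurable_of_measurable_coe _ fun s hs => ?_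
  have h : ∀ x : EuclideanSpace ℝ (Fin n), multivariateGaussian (act G x) Γobs s
      = stdGaussian (EuclideanSpace ℝ (Fin m))
          (Prod.mk x ⁻¹' ((fun p : EuclideanSpace ℝ (Fin n) × EuclideanSpace ℝ (Fin m) =>
            act G p.1 + L p.2) ⁻¹' s)) := fun x => by
    rw [multivariateGaussian, Measure.map_apply (by fun_prop) hs]
    rfl
  simp_rw [h]
  exact measurable_measure_prodMk_left (by measurability)

/-- The likelihood: the conditional distribution `N(G x, Γobs)` of the data `y` given `x`. -/
def likelihood (G : Matrix (Fin m) (Fin n) ℝ) (Γobs : Matrix (Fin m) (Fin m) ℝ) :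
    Kernel (EuclideanSpace ℝ (Fin n)) (EuclideanSpace ℝ (Fin m)) where
  toFun x := multivariateGaussian (act G x) Γobs
  measurable' := measurable_gaussian_mean G Γobs

instance (G : Matrix (Fin m) (Fin n) ℝ) (Γobs : Matrix (Fin m) (Fin m) ℝ) :
    IsMarkovKernel (likelihood G Γobs) :=
  ⟨fun x => by change IsProbabilityMeasure (multivariateGaussian (act G x) Γobs); infer_instance⟩

/-- The joint distribution of `(x, y)`. -/
def joint (Γpr : Matrix (Fin n) (Fin n) ℝ) (Γobs : Matrix (Fin m) (Fin m) ℝ)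
    (G : Matrix (Fin m) (Fin n) ℝ) :
    Measure (EuclideanSpace ℝ (Fin n) × EuclideanSpace ℝ (Fin m)) :=
  prior Γpr ⊗ₘ likelihood G Γobs

/-- The posterior mean `μ_pos(y) = E(x ∣ y)`: the mean of the posterior distribution of `x`
given the data `y`. -/
def postMean (Γpr : Matrix (Fin n) (Fin n) ℝ) (Γobs : Matrix (Fin m) (Fin m) ℝ)
    (G : Matrix (Fin m) (Fin n) ℝ) (y : EuclideanSpace ℝ (Fin m)) : EuclideanSpace ℝ (Fin n) :=
  ∫ x, x ∂(posterior (likelihood G Γobs) (prior Γpr) y)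

/-- The Hessian of the negative log-likelihood, `H = Gᵀ Γobs⁻¹ G`. -/
def hessian (Γobs : Matrix (Fin m) (Fin m) ℝ) (G : Matrix (Fin m) (Fin n) ℝ) :
    Matrix (Fin n) (Fin n) ℝ :=
  Gᵀ * Γobs⁻¹ * G

/-- The posterior covariance matrix `Γ_pos = (H + Γpr⁻¹)⁻¹`. -/
def postCov (Γpr : Matrix (Fin n) (Fin n) ℝ) (Γobs : Matrix (Fin m) (Fin m) ℝ)
    (G : Matrix (Fin m) (Fin n) ℝ) : Matrix (Fin n) (Fin n) ℝ :=
  (hessian Γobs G + Γpr⁻¹)⁻¹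

/-- The loss `‖δ(y) - x‖²` of the estimator `δ` in the norm induced by `Γ_pos⁻¹`, as a function of
the pair `(x, y)`. -/
def loss (Γpr : Matrix (Fin n) (Fin n) ℝ) (Γobs : Matrix (Fin m) (Fin m) ℝ)
    (G : Matrix (Fin m) (Fin n) ℝ)
    (δ : EuclideanSpace ℝ (Fin m) → EuclideanSpace ℝ (Fin n))
    (p : EuclideanSpace ℝ (Fin n) × EuclideanSpace ℝ (Fin m)) : ℝ :=
  sqNorm (postCov Γpr Γobs G)⁻¹ (δ p.2 - p.1)

/-- The Bayes risk of the estimator `δ`: the expectation of the loss over the joint distribution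
of `x` and `y`. -/
def bayesRisk (Γpr : Matrix (Fin n) (Fin n) ℝ) (Γobs : Matrix (Fin m) (Fin m) ℝ)
    (G : Matrix (Fin m) (Fin n) ℝ)
    (δ : EuclideanSpace ℝ (Fin m) → EuclideanSpace ℝ (Fin n)) : ℝ :=
  ∫ p, loss Γpr Γobs G δ p ∂(joint Γpr Γobs G)

/-! ### Approximation classes -/

/-- The class `𝓜_r` of positive definite matrices `Γpr - K Kᵀ` with `rank K ≤ r`. -/
def covClass (Γpr : Matrix (Fin n) (Fin n) ℝ) (r : ℕ) : Set (Matrix (Fin n) (Fin n) ℝ) :=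
  {M | M.PosDef ∧ ∃ (k : ℕ) (K : Matrix (Fin n) (Fin k) ℝ), K.rank ≤ r ∧ M = Γpr - K * Kᵀ}

/-- The class `𝓐̂_r` of matrices `(Γpr - B) Gᵀ Γobs⁻¹` with `rank B ≤ r`. -/
def meanClass (Γpr : Matrix (Fin n) (Fin n) ℝ) (Γobs : Matrix (Fin m) (Fin m) ℝ)
    (G : Matrix (Fin m) (Fin n) ℝ) (r : ℕ) : Set (Matrix (Fin n) (Fin m) ℝ) :=
  {A | ∃ B : Matrix (Fin n) (Fin n) ℝ, B.rank ≤ r ∧ A = (Γpr - B) * Gᵀ * Γobs⁻¹}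

/-- `(δ i ^ 2, w i)` are the generalized eigenvalue-eigenvector pairs of the pencil
`(H, Γpr⁻¹)`, in non-increasing order of the eigenvalues and with eigenvectors that are
orthonormal with respect to `Γpr⁻¹`. -/
structure IsEigenpairs (Γpr : Matrix (Fin n) (Fin n) ℝ) (Γobs : Matrix (Fin m) (Fin m) ℝ)
    (G : Matrix (Fin m) (Fin n) ℝ) (δ : Fin n → ℝ) (w : Fin n → Fin n → ℝ) : Prop where
  nonneg : ∀ i, 0 ≤ δ i
  antitone : ∀ i j, i ≤ j → δ j ^ 2 ≤ δ i ^ 2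
  eigen : ∀ i, hessian Γobs G *ᵥ w i = δ i ^ 2 • (Γpr⁻¹ *ᵥ w i)
  orthonormal : ∀ i j, w i ⬝ᵥ (Γpr⁻¹ *ᵥ w j) = if i = j then 1 else 0

/-- The optimal approximation of the posterior covariance matrix,
`Γ̂_pos = Γpr - ∑_{i ≤ r} δ_i² (1 + δ_i²)⁻¹ w_i w_iᵀ` (the indices in `Fin n` start at `0`). -/
def optCov (Γpr : Matrix (Fin n) (Fin n) ℝ) (δ : Fin n → ℝ) (w : Fin n → Fin n → ℝ) (r : ℕ) :
    Matrix (Fin n) (Fin n) ℝ :=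
  Γpr - ∑ i : Fin n with i.val < r, (δ i ^ 2 * (1 + δ i ^ 2)⁻¹) • vecMulVec (w i) (w i)

end BayesLinear

end

/-! Write `y = G x + e` with `e ∼ N(0, Γobs)` independent of `x`. Every error of an estimator linear
in `y` is then a linear image of one centred Gaussian vector, so each expected squared norm is a
trace of covariances (`integral_joint`). The posterior mean is linear too: for `K = Γ_pos Gᵀ Γobs⁻¹`
the residual `x - K y` is uncorrelated with `y`, hence independent of it by Gaussianity, and the
posterior at `y` is a translate by `K y` of one centred law.

Let `W` have the columns `w i`, and let `D` be the diagonal matrix of the `δ i ^ 2`. With `V = W⁻¹`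
one has `Γpr = W Wᵀ`, `H = Vᵀ D V` and `Γ_pos⁻¹ = Vᵀ (1 + D) V`. For `A = W c Wᵀ Gᵀ Γobs⁻¹`,
completing the square entrywise turns the Bayes risk into `n` plus a weighted Frobenius distance
from `c` to `(1 + D)⁻¹` (`IsWhitening.bayesRisk_eq`). The second term is the mean squared distance
to the posterior mean, which gives the decomposition in (ii).

Members of the class correspond to `c = 1 - b` with `rank b ≤ r`. Absorbing the weights into `b`
makes the excess risk the squared Frobenius distance from `diag (δ ^ 3)` to a matrix of rank at most
`r`. Eckart–Young (`sum_sq_le_sum_sq_diagonal_sub`) bounds it below by the tail sum of `δ ^ 6`, and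
the truncated diagonal `b` defining `optCov` attains the bound. -/

noncomputable section

namespace BayesLinear

variable {n m k l : ℕ}

/-! ### Matrices acting on Euclidean spaces -/

/-- The action of a matrix on column vectors as a continuous linear map. -/
def actCLM (A : Matrix (Fin k) (Fin l) ℝ) :
    EuclideanSpace ℝ (Fin l) →L[ℝ] EuclideanSpace ℝ (Fin k) :=
  (Matrix.toLpLin 2 2 A).toContinuousLinearMap

theorem actCLM_apply (A : Matrix (Fin k) (Fin l) ℝ) (x : EuclideanSpace ℝ (Fin l)) :
    actCLM A x = act A x := rfl

theorem act_apply (A : Matrix (Fin k) (Fin l) ℝ) (x : EuclideanSpace ℝ (Fin l)) (i : Fin k) :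
    act A x i = ∑ j, A i j * x j := rfl

theorem act_add (A : Matrix (Fin k) (Fin l) ℝ) (x y : EuclideanSpace ℝ (Fin l)) :
    act A (x + y) = act A x + act A y := map_add (actCLM A) x y

theorem act_act {j : ℕ} (A : Matrix (Fin k) (Fin l) ℝ) (B : Matrix (Fin l) (Fin j) ℝ)
    (x : EuclideanSpace ℝ (Fin j)) : act A (act B x) = act (A * B) x := by
  simp [act, Matrix.mulVec_mulVec]

theorem add_act (A B : Matrix (Fin k) (Fin l) ℝ) (x : EuclideanSpace ℝ (Fin l)) :
    act (A + B) x = act A x + act B x := by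
  ext i; simp [act, Matrix.add_mulVec]

theorem sub_act (A B : Matrix (Fin k) (Fin l) ℝ) (x : EuclideanSpace ℝ (Fin l)) :
    act (A - B) x = act A x - act B x := by
  ext i; simp [act, Matrix.sub_mulVec]

theorem act_one (x : EuclideanSpace ℝ (Fin l)) : act 1 x = x := by
  ext i; simp [act]

/-! ### The joint law as the image of an independent Gaussian pair -/

theorem compProd_eq_map_of_translate (μ : Measure (EuclideanSpace ℝ (Fin k)))
    (ρ : Measure (EuclideanSpace ℝ (Fin l))) [IsProbabilityMeasure μ] [IsProbabilityMeasure ρ]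
    {f : EuclideanSpace ℝ (Fin k) → EuclideanSpace ℝ (Fin l)} (hf : Measurable f)
    (κ : Kernel (EuclideanSpace ℝ (Fin k)) (EuclideanSpace ℝ (Fin l))) [IsSFiniteKernel κ]
    (h : ∀ x, κ x = ρ.map (fun u => f x + u)) :
    μ ⊗ₘ κ = (μ.prod ρ).map (fun p => (p.1, f p.1 + p.2)) := by
  ext s hs
  rw [Measure.compProd_apply hs, Measure.map_apply (by fun_prop) hs,
    Measure.prod_apply (by measurability)]
  refine lintegral_congr fun x => ?_
  rw [h, Measure.map_apply (by fun_prop) (measurable_prodMk_left hs)]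
  rfl

theorem multivariateGaussian_eq_map_add (a : EuclideanSpace ℝ (Fin k))
    (S : Matrix (Fin k) (Fin k) ℝ) :
    multivariateGaussian a S = (multivariateGaussian 0 S).map (fun u => a + u) := by
  rw [multivariateGaussian, multivariateGaussian, Measure.map_map (by fun_prop) (by fun_prop)]
  congr 1
  ext1 x
  simp

/-- The law of the pair `(x, e)` of the parameter and an independent observation error. -/
def paramErrorLaw (Γpr : Matrix (Fin n) (Fin n) ℝ) (Γobs : Matrix (Fin m) (Fin m) ℝ) :
    Measure (EuclideanSpace ℝ (Fin n) × EuclideanSpace ℝ (Fin m)) :=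
  (multivariateGaussian 0 Γpr).prod (multivariateGaussian 0 Γobs)

instance (Γpr : Matrix (Fin n) (Fin n) ℝ) (Γobs : Matrix (Fin m) (Fin m) ℝ) :
    IsProbabilityMeasure (paramErrorLaw Γpr Γobs) := by
  unfold paramErrorLaw; infer_instance

theorem measurable_pair_data (G : Matrix (Fin m) (Fin n) ℝ) :
    Measurable (fun p : EuclideanSpace ℝ (Fin n) × EuclideanSpace ℝ (Fin m) =>
      (p.1, act G p.1 + p.2)) := by
  have := measurable_act G
  fun_prop

/-- This is the representation `y = G x + e`: the likelihood at `x` is the translate by `G x` of one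
fixed noise law. -/
theorem joint_eq_map (Γpr : Matrix (Fin n) (Fin n) ℝ) (Γobs : Matrix (Fin m) (Fin m) ℝ)
    (G : Matrix (Fin m) (Fin n) ℝ) :
    joint Γpr Γobs G = (paramErrorLaw Γpr Γobs).map (fun p => (p.1, act G p.1 + p.2)) :=
  compProd_eq_map_of_translate _ _ (measurable_act G) _
    fun x => multivariateGaussian_eq_map_add (act G x) Γobs

/-! ### First and second moments of linear images -/

/-- The linear image `L x + M e` of the pair `(x, e)`. -/
def linComb (L : Matrix (Fin k) (Fin n) ℝ) (M : Matrix (Fin k) (Fin m) ℝ)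
    (p : EuclideanSpace ℝ (Fin n) × EuclideanSpace ℝ (Fin m)) : EuclideanSpace ℝ (Fin k) :=
  act L p.1 + act M p.2

/-- `linComb` as a continuous linear map. -/
def linCombCLM (L : Matrix (Fin k) (Fin n) ℝ) (M : Matrix (Fin k) (Fin m) ℝ) :
    EuclideanSpace ℝ (Fin n) × EuclideanSpace ℝ (Fin m) →L[ℝ] EuclideanSpace ℝ (Fin k) :=
  (actCLM L).coprod (actCLM M)

theorem linCombCLM_apply (L : Matrix (Fin k) (Fin n) ℝ) (M : Matrix (Fin k) (Fin m) ℝ)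
    (p : EuclideanSpace ℝ (Fin n) × EuclideanSpace ℝ (Fin m)) :
    linCombCLM L M p = linComb L M p := rfl

theorem measurable_linComb (L : Matrix (Fin k) (Fin n) ℝ) (M : Matrix (Fin k) (Fin m) ℝ) :
    Measurable (linComb L M) := (linCombCLM L M).measurable

theorem hasGaussianLaw_paramErrorLaw (Γpr : Matrix (Fin n) (Fin n) ℝ)
    (Γobs : Matrix (Fin m) (Fin m) ℝ) : HasGaussianLaw id (paramErrorLaw Γpr Γobs) := by
  have h1 : HasGaussianLaw (fun p : EuclideanSpace ℝ (Fin n) × EuclideanSpace ℝ (Fin m) => p.1)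
      (paramErrorLaw Γpr Γobs) := by
    refine ⟨?_⟩
    rw [paramErrorLaw, measurePreserving_fst.map_eq]
    infer_instance
  have h2 : HasGaussianLaw (fun p : EuclideanSpace ℝ (Fin n) × EuclideanSpace ℝ (Fin m) => p.2)
      (paramErrorLaw Γpr Γobs) := by
    refine ⟨?_⟩
    rw [paramErrorLaw, measurePreserving_snd.map_eq]
    infer_instance
  exact IndepFun.hasGaussianLaw h1 h2 (indepFun_prod₀ aemeasurable_id aemeasurable_id)

theorem integral_linComb (Γpr : Matrix (Fin n) (Fin n) ℝ) (Γobs : Matrix (Fin m) (Fin m) ℝ)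
    (L : Matrix (Fin k) (Fin n) ℝ) (M : Matrix (Fin k) (Fin m) ℝ) :
    ∫ p, linComb L M p ∂(paramErrorLaw Γpr Γobs) = 0 := by
  have hx : Integrable (fun p : EuclideanSpace ℝ (Fin n) × EuclideanSpace ℝ (Fin m) => p.1)
      (paramErrorLaw Γpr Γobs) := IsGaussian.integrable_fun_id.comp_fst _
  have he : Integrable (fun p : EuclideanSpace ℝ (Fin n) × EuclideanSpace ℝ (Fin m) => p.2)
      (paramErrorLaw Γpr Γobs) := IsGaussian.integrable_fun_id.comp_snd _
  have h1 : ∫ p, p.1 ∂(paramErrorLaw Γpr Γobs) = 0 := by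
    rw [paramErrorLaw, integral_fun_fst (fun x => x)]; simp
  have h2 : ∫ p, p.2 ∂(paramErrorLaw Γpr Γobs) = 0 := by
    rw [paramErrorLaw, integral_fun_snd (fun x => x)]; simp
  simp only [linComb, ← actCLM_apply]
  rw [integral_add ((actCLM L).integrable_comp hx) ((actCLM M).integrable_comp he),
    (actCLM L).integral_comp_comm hx, (actCLM M).integral_comp_comm he, h1, h2]
  simp

theorem memLp_linComb_eval (Γpr : Matrix (Fin n) (Fin n) ℝ) (Γobs : Matrix (Fin m) (Fin m) ℝ)
    (L : Matrix (Fin k) (Fin n) ℝ) (M : Matrix (Fin k) (Fin m) ℝ) (i : Fin k) :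
    MemLp (fun p => linComb L M p i) 2 (paramErrorLaw Γpr Γobs) :=
  ((hasGaussianLaw_paramErrorLaw Γpr Γobs).map
    ((EuclideanSpace.proj i).comp (linCombCLM L M))).memLp_two

theorem covariance_act_eval {S : Matrix (Fin n) (Fin n) ℝ} (hS : S.PosSemidef)
    (L : Matrix (Fin k) (Fin n) ℝ) (L' : Matrix (Fin l) (Fin n) ℝ) (i : Fin k) (j : Fin l) :
    cov[fun x => act L x i, fun x => act L' x j; multivariateGaussian 0 S] =
      (L * S * L'ᵀ) i j := by
  have hm (a : Fin n) (c : ℝ) :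
      MemLp (fun x : EuclideanSpace ℝ (Fin n) => c * x a) 2 (multivariateGaussian 0 S) :=
    MemLp.const_mul (((IsGaussian.hasGaussianLaw_id (μ := multivariateGaussian 0 S)).map
      (EuclideanSpace.proj a)).memLp_two) c
  simp only [act_apply]
  rw [covariance_fun_sum_fun_sum (fun a => hm a _) (fun a => hm a _)]
  simp_rw [covariance_const_mul_left, covariance_const_mul_right,
    covariance_eval_multivariateGaussian hS, Matrix.mul_apply, Finset.sum_mul,
    Matrix.transpose_apply]
  rw [Finset.sum_comm]
  exact Finset.sum_congr rfl fun _ _ => Finset.sum_congr rfl fun _ _ => by ring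

theorem memLp_act_eval (S : Matrix (Fin n) (Fin n) ℝ) (L : Matrix (Fin k) (Fin n) ℝ) (i : Fin k) :
    MemLp (fun x => act L x i) 2 (multivariateGaussian 0 S) :=
  ((IsGaussian.hasGaussianLaw_id (μ := multivariateGaussian 0 S)).map
      ((EuclideanSpace.proj i).comp (actCLM L))).memLp_two

theorem covariance_linComb {Γpr : Matrix (Fin n) (Fin n) ℝ} {Γobs : Matrix (Fin m) (Fin m) ℝ}
    (hpr : Γpr.PosSemidef) (hobs : Γobs.PosSemidef)
    (L : Matrix (Fin k) (Fin n) ℝ) (M : Matrix (Fin k) (Fin m) ℝ)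
    (L' : Matrix (Fin l) (Fin n) ℝ) (M' : Matrix (Fin l) (Fin m) ℝ) (i : Fin k) (j : Fin l) :
    cov[fun p => linComb L M p i, fun p => linComb L' M' p j; paramErrorLaw Γpr Γobs] =
      (L * Γpr * L'ᵀ + M * Γobs * M'ᵀ) i j := by
  have hx {k : ℕ} (L : Matrix (Fin k) (Fin n) ℝ) (i : Fin k) : MemLp
      (fun p : EuclideanSpace ℝ (Fin n) × EuclideanSpace ℝ (Fin m) => act L p.1 i) 2
      (paramErrorLaw Γpr Γobs) := (memLp_act_eval Γpr L i).comp_fst _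
  have he {k : ℕ} (M : Matrix (Fin k) (Fin m) ℝ) (i : Fin k) : MemLp
      (fun p : EuclideanSpace ℝ (Fin n) × EuclideanSpace ℝ (Fin m) => act M p.2 i) 2
      (paramErrorLaw Γpr Γobs) := (memLp_act_eval Γobs M i).comp_snd _
  have e {k : ℕ} (L : Matrix (Fin k) (Fin n) ℝ) (M : Matrix (Fin k) (Fin m) ℝ) (i : Fin k) :
      (fun p => linComb L M p i) = (fun p => act L p.1 i) + fun p => act M p.2 i := rfl
  rw [e, e, covariance_add_left (hx L i) (he M i) ((hx L' j).add (he M' j)),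
    covariance_add_right (hx L i) (hx L' j) (he M' j),
    covariance_add_right (he M i) (hx L' j) (he M' j),
    covariance_comm (fun p : EuclideanSpace ℝ (Fin n) × EuclideanSpace ℝ (Fin m) => act M p.2 i)
      fun p : EuclideanSpace ℝ (Fin n) × EuclideanSpace ℝ (Fin m) => act L' p.1 j]
  have h1 : cov[fun p => act L p.1 i, fun p => act L' p.1 j; paramErrorLaw Γpr Γobs] =
      (L * Γpr * L'ᵀ) i j := by
    rw [← covariance_act_eval hpr]
    conv_rhs => rw [← (measurePreserving_fst (μ := multivariateGaussian 0 Γpr)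
      (ν := multivariateGaussian 0 Γobs)).map_eq]
    rw [covariance_map]
    · rfl
    · exact (((EuclideanSpace.proj i).comp (actCLM L)).continuous).aestronglyMeasurable
    · exact (((EuclideanSpace.proj j).comp (actCLM L')).continuous).aestronglyMeasurable
    · fun_prop
  have h2 : cov[fun p => act M p.2 i, fun p => act M' p.2 j; paramErrorLaw Γpr Γobs] =
      (M * Γobs * M'ᵀ) i j := by
    rw [← covariance_act_eval hobs]
    conv_rhs => rw [← (measurePreserving_snd (μ := multivariateGaussian 0 Γpr)
      (ν := multivariateGaussian 0 Γobs)).map_eq]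
    rw [covariance_map]
    · rfl
    · exact (((EuclideanSpace.proj i).comp (actCLM M)).continuous).aestronglyMeasurable
    · exact (((EuclideanSpace.proj j).comp (actCLM M')).continuous).aestronglyMeasurable
    · fun_prop
  -- The two cross covariances vanish because `x` and `e` are independent.
  rw [h1, h2, paramErrorLaw,
    covariance_fst_snd_prod (memLp_act_eval Γpr L i) (memLp_act_eval Γobs M' j),
    covariance_fst_snd_prod (memLp_act_eval Γpr L' j) (memLp_act_eval Γobs M i)]
  simp

theorem integral_linComb_eval (Γpr : Matrix (Fin n) (Fin n) ℝ) (Γobs : Matrix (Fin m) (Fin m) ℝ)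
    (L : Matrix (Fin k) (Fin n) ℝ) (M : Matrix (Fin k) (Fin m) ℝ) (i : Fin k) :
    ∫ p, linComb L M p i ∂(paramErrorLaw Γpr Γobs) = 0 := by
  have h := (EuclideanSpace.proj (𝕜 := ℝ) i).integral_comp_comm
    (((hasGaussianLaw_paramErrorLaw Γpr Γobs).map (linCombCLM L M)).integrable)
  simp only [Function.comp_apply, id_eq, linCombCLM_apply, integral_linComb] at h
  simpa using h

theorem sqNorm_eq_sum (S : Matrix (Fin n) (Fin n) ℝ) (v : EuclideanSpace ℝ (Fin n)) :
    sqNorm S v = ∑ i, ∑ j, S i j * (v i * v j) := by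
  simp only [sqNorm, dotProduct, mulVec, Finset.mul_sum]
  exact Finset.sum_congr rfl fun _ _ => Finset.sum_congr rfl fun _ _ => by ring

theorem integrable_sqNorm_linComb (Γpr : Matrix (Fin n) (Fin n) ℝ)
    (Γobs : Matrix (Fin m) (Fin m) ℝ) (S : Matrix (Fin k) (Fin k) ℝ)
    (L : Matrix (Fin k) (Fin n) ℝ) (M : Matrix (Fin k) (Fin m) ℝ) :
    Integrable (fun p => sqNorm S (linComb L M p)) (paramErrorLaw Γpr Γobs) := by
  simp only [sqNorm_eq_sum]
  exact integrable_finsetSum _ fun i _ => integrable_finsetSum _ fun j _ =>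
    ((memLp_linComb_eval Γpr Γobs L M i).integrable_mul
      (memLp_linComb_eval Γpr Γobs L M j)).const_mul _

/-- Since `linComb L M` is centred, its second moments are covariances. The transpose on `S` makes
the trace formula valid without symmetry of `S`. -/
theorem integral_sqNorm_linComb {Γpr : Matrix (Fin n) (Fin n) ℝ} {Γobs : Matrix (Fin m) (Fin m) ℝ}
    (hpr : Γpr.PosSemidef) (hobs : Γobs.PosSemidef) (S : Matrix (Fin k) (Fin k) ℝ)
    (L : Matrix (Fin k) (Fin n) ℝ) (M : Matrix (Fin k) (Fin m) ℝ) :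
    ∫ p, sqNorm S (linComb L M p) ∂(paramErrorLaw Γpr Γobs) =
      (Sᵀ * (L * Γpr * Lᵀ + M * Γobs * Mᵀ)).trace := by
  have hint (i j : Fin k) :
      Integrable (fun p => S i j * (linComb L M p i * linComb L M p j)) (paramErrorLaw Γpr Γobs) :=
    ((memLp_linComb_eval Γpr Γobs L M i).integrable_mul
      (memLp_linComb_eval Γpr Γobs L M j)).const_mul (S i j)
  simp only [sqNorm_eq_sum]
  rw [integral_finsetSum _ fun i _ => integrable_finsetSum _ fun j _ => hint i j]
  simp_rw [Matrix.trace, Matrix.diag, Matrix.mul_apply (M := Sᵀ), Matrix.transpose_apply]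
  rw [Finset.sum_comm' (t' := Finset.univ) (s' := fun _ => Finset.univ) (by simp)]
  refine Finset.sum_congr rfl fun i _ => ?_
  rw [integral_finsetSum _ fun j _ => hint i j]
  refine Finset.sum_congr rfl fun j _ => ?_
  rw [integral_const_mul, ← covariance_linComb hpr hobs,
    covariance_eq_sub (memLp_linComb_eval Γpr Γobs L M i) (memLp_linComb_eval Γpr Γobs L M j),
    integral_linComb_eval, zero_mul, sub_zero]
  rfl

/-! ### The posterior mean -/

/-- The posterior mean: if `x - K y` is uncorrelated with `y` then `E (x ∣ y) = K y`. -/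
theorem postMean_ae_eq {Γpr : Matrix (Fin n) (Fin n) ℝ} {Γobs : Matrix (Fin m) (Fin m) ℝ}
    (hpr : Γpr.PosSemidef) (hobs : Γobs.PosSemidef) (G : Matrix (Fin m) (Fin n) ℝ)
    {K : Matrix (Fin n) (Fin m) ℝ} (hK : K * (G * Γpr * Gᵀ + Γobs) = Γpr * Gᵀ) :
    ∀ᵐ p ∂(joint Γpr Γobs G), postMean Γpr Γobs G p.2 = act K p.2 := by
  set ν := paramErrorLaw Γpr Γobs
  set Y := linComb (n := n) (m := m) G 1
  -- `U = x - K y` is the residual, expressed through `x` and `e`.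
  set U := linComb (n := n) (m := m) (1 - K * G) (-K)
  have hYm : Measurable Y := measurable_linComb _ _
  have hUm : Measurable U := measurable_linComb _ _
  have hY (p : EuclideanSpace ℝ (Fin n) × EuclideanSpace ℝ (Fin m)) :
      Y p = act G p.1 + p.2 := by simp [Y, linComb, act_one]
  have hU (p : EuclideanSpace ℝ (Fin n) × EuclideanSpace ℝ (Fin m)) :
      act K (Y p) + U p = p.1 := by
    rw [hY, act_add, act_act]
    simp only [U, linComb, sub_act, act_one, neg_eq_zero_sub, sub_act]
    have : act (0 : Matrix (Fin n) (Fin m) ℝ) p.2 = 0 := by ext; simp [act]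
    rw [this]; abel
  have hind : IndepFun Y U ν := by
    have hlaw := (hasGaussianLaw_paramErrorLaw Γpr Γobs).map
      (((EuclideanSpace.equiv (Fin m) ℝ).toContinuousLinearMap.comp (linCombCLM G 1)).prod
        ((EuclideanSpace.equiv (Fin n) ℝ).toContinuousLinearMap.comp
          (linCombCLM (1 - K * G) (-K))))
    refine (HasGaussianLaw.indepFun_of_covariance_eval (X := fun i p => Y p i)
      (Y := fun j p => U p j) hlaw fun i j => ?_).comp
      (WithLp.measurable_toLp 2 (Fin m → ℝ)) (WithLp.measurable_toLp 2 (Fin n → ℝ))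
    rw [covariance_linComb hpr hobs]
    have hK' := congrArg Matrix.transpose hK
    have h1 : Γprᵀ = Γpr := hpr.isHermitian
    have h2 : Γobsᵀ = Γobs := hobs.isHermitian
    simp only [Matrix.transpose_mul, Matrix.transpose_add, Matrix.transpose_transpose, h1, h2]
      at hK'
    -- The covariance of `Y` and `U` is `G Γpr - (G Γpr Gᵀ + Γobs) Kᵀ`, which is zero by the
    -- transpose of `hK`.
    have : G * Γpr * (1 - K * G)ᵀ + 1 * Γobs * (-K)ᵀ = 0 := by
      rw [← sub_self (G * Γpr)]
      nth_rewrite 3 [← hK']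
      simp only [Matrix.transpose_sub, Matrix.transpose_one, Matrix.transpose_mul,
        Matrix.transpose_neg, Matrix.mul_sub, Matrix.mul_one, Matrix.one_mul, Matrix.mul_neg,
        Matrix.add_mul, Matrix.mul_assoc]
      abel
    rw [this, Matrix.zero_apply]
  -- Read in the order `(y, x)`, the joint law is that of `(Y, K Y + U)` with `U` independent of
  -- `Y`; this disintegrates it over the data.
  have hmap : (joint Γpr Γobs G).map Prod.swap = ((ν.map Y).prod (ν.map U)).map
      (fun q => (q.1, act K q.1 + q.2)) := by
    have hKm := measurable_act K
    rw [← (indepFun_iff_map_prod_eq_prod_map_map hYm.aemeasurable hUm.aemeasurable).1 hind,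
      joint_eq_map, Measure.map_map (by fun_prop) (measurable_pair_data G),
      Measure.map_map (by fun_prop) (by fun_prop)]
    congr 1
    ext1 p
    simp only [Function.comp_apply, hU, ← hY, Prod.swap]
  have : IsProbabilityMeasure (ν.map Y) := Measure.isProbabilityMeasure_map hYm.aemeasurable
  have : IsProbabilityMeasure (ν.map U) := Measure.isProbabilityMeasure_map hUm.aemeasurable
  let η : Kernel (EuclideanSpace ℝ (Fin m)) (EuclideanSpace ℝ (Fin n)) :=
    (Kernel.id ×ₖ Kernel.const _ (ν.map U)).map (fun q => act K q.1 + q.2)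
  have hadd : Measurable (fun q : EuclideanSpace ℝ (Fin m) × EuclideanSpace ℝ (Fin n) =>
      act K q.1 + q.2) := by
    have hKm := measurable_act K
    fun_prop
  have hη (y) : η y = (ν.map U).map (fun u => act K y + u) := by
    rw [Kernel.map_apply _ hadd, Kernel.prod_apply, Kernel.id_apply, Kernel.const_apply,
      Measure.dirac_prod, Measure.map_map hadd (by fun_prop)]
    rfl
  have : IsMarkovKernel η := Kernel.IsMarkovKernel.map _ hadd
  have hmarg : likelihood G Γobs ∘ₘ prior Γpr = ν.map Y := by
    rw [← Measure.snd_compProd]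
    change (joint Γpr Γobs G).snd = _
    rw [joint_eq_map, Measure.snd, Measure.map_map measurable_snd (measurable_pair_data G)]
    congr 1
    ext1 p
    simp [hY]
  -- Uniqueness of the disintegration: the posterior agrees with `η` for almost every `y`.
  have hpost := ae_eq_posterior_of_compProd_eq (κ := likelihood G Γobs) (μ := prior Γpr) (η := η)
    (by
      rw [hmarg, compProd_eq_map_of_translate _ _ (measurable_act K) η hη, ← hmap]
      rfl)
  have hsnd : (joint Γpr Γobs G).map Prod.snd = likelihood G Γobs ∘ₘ prior Γpr :=
    Measure.snd_compProd _ _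
  rw [← hsnd] at hpost
  filter_upwards [ae_of_ae_map (by fun_prop) hpost] with p hp
  have hUint : Integrable (fun u => u) (ν.map U) :=
    ((hasGaussianLaw_paramErrorLaw Γpr Γobs).map (linCombCLM (1 - K * G) (-K))).isGaussian_map
      |>.integrable_fun_id
  have hUzero : ∫ u, u ∂(ν.map U) = 0 :=
    (integral_map hUm.aemeasurable aestronglyMeasurable_id).trans (integral_linComb Γpr Γobs _ _)
  rw [postMean, ← hp, hη, integral_map (by fun_prop) (by fun_prop),
    integral_add (integrable_const _) hUint, hUzero]
  simp

/-! ### The Eckart–Young bound for a diagonal matrix -/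

theorem sum_filter_le_sum_mul_one_sub {n : ℕ} (r : ℕ) {a p : Fin n → ℝ} (ha : Antitone a)
    (ha0 : ∀ i, 0 ≤ a i) (hp0 : ∀ i, 0 ≤ p i) (hp1 : ∀ i, p i ≤ 1) (hp : ∑ i, p i ≤ r) :
    ∑ i with r ≤ i.val, a i ≤ ∑ i, a i * (1 - p i) := by
  rcases le_or_gt n r with hr | hr
  · rw [Finset.filter_false_of_mem fun i _ => by have := i.2; omega, Finset.sum_empty]
    exact Finset.sum_nonneg fun i _ => mul_nonneg (ha0 i) (sub_nonneg.2 (hp1 i))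
  -- The threshold `t` is the `(r + 1)`-st largest value. Replacing each `a i` by `t` in the
  -- difference of the two sides can only lower it, because `1 - p i ≥ 0` before index `r` and `-p i
  -- ≤ 0` from there on. What remains is `t * (r - ∑ p) ≥ 0`.
  · set t := a ⟨r, hr⟩
    have hcard : ∑ i : Fin n, (if r ≤ i.val then (0 : ℝ) else 1) = r := by
      rw [Fin.sum_univ_eq_sum_range (fun i => if r ≤ i then (0 : ℝ) else 1) n,
        ← Finset.sum_range_add_sum_Ico _ hr.le,
        Finset.sum_congr rfl (g := fun _ => (1 : ℝ)) fun i hi => by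
          rw [if_neg (by simpa using hi)],
        Finset.sum_eq_zero (s := Finset.Ico r n) fun i hi => by
          rw [if_pos (Finset.mem_Ico.1 hi).1]]
      simp
    rw [Finset.sum_filter, ← sub_nonneg, ← Finset.sum_sub_distrib]
    calc (0 : ℝ) ≤ t * (r - ∑ i, p i) := mul_nonneg (ha0 _) (sub_nonneg.2 hp)
      _ = ∑ i : Fin n, t * ((if r ≤ i.val then (0 : ℝ) else 1) - p i) := by
        rw [← Finset.mul_sum, Finset.sum_sub_distrib, hcard]
      _ ≤ _ := Finset.sum_le_sum fun i _ => ?_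
    split_ifs with h
    · nlinarith [ha (show (⟨r, hr⟩ : Fin n) ≤ i from h), hp0 i]
    · nlinarith [ha (show i ≤ (⟨r, hr⟩ : Fin n) from (not_le.1 h).le), hp1 i]

/-- Both sides are the trace of the orthogonal projection onto `U`. -/
theorem sum_norm_sq_starProjection {n : ℕ} (U : Submodule ℝ (EuclideanSpace ℝ (Fin n))) :
    ∑ i, ‖U.starProjection (EuclideanSpace.basisFun (Fin n) ℝ i)‖ ^ 2 = Module.finrank ℝ U := by
  have h : LinearMap.IsProj U (U.starProjection : EuclideanSpace ℝ (Fin n) →ₗ[ℝ] _) :=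
    ⟨fun x => U.starProjection_apply_mem x,
      fun x hx => U.starProjection_eq_self_iff.2 hx⟩
  rw [← h.trace, LinearMap.trace_eq_sum_inner _ (EuclideanSpace.basisFun (Fin n) ℝ)]
  refine Finset.sum_congr rfl fun i _ => ?_
  have := U.re_inner_starProjection_eq_normSq (EuclideanSpace.basisFun (Fin n) ℝ i)
  rw [real_inner_comm]
  simpa using this.symm

/-- The **Eckart–Young theorem** in the Frobenius norm for a diagonal matrix. -/
theorem sum_sq_le_sum_sq_diagonal_sub {n r : ℕ} {s : Fin n → ℝ} (hs : Antitone fun i => s i ^ 2)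
    {b : Matrix (Fin n) (Fin n) ℝ} (hb : b.rank ≤ r) :
    ∑ i with r ≤ i.val, s i ^ 2 ≤ ∑ i, ∑ j, (diagonal s - b) i j ^ 2 := by
  set e := EuclideanSpace.basisFun (Fin n) ℝ
  set U := LinearMap.range (Matrix.toLpLin 2 2 b)
  have hU : Module.finrank ℝ U = b.rank := by
    rw [Matrix.rank_eq_finrank_range_toLin b (PiLp.basisFun 2 ℝ _) (PiLp.basisFun 2 ℝ _),
      ← Matrix.toLpLin_eq_toLin]
  have hnorm (i) : ‖U.starProjection (e i)‖ ≤ 1 :=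
    (U.norm_starProjection_apply_le _).trans (e.norm_eq_one i).le
  -- Column `j` of `b` lies in the range `U`, so its distance to `s j • e j` is at least the norm of
  -- the component of `s j • e j` orthogonal to `U`.
  have hcol (j) : s j ^ 2 * (1 - ‖U.starProjection (e j)‖ ^ 2) ≤
      ∑ i, (diagonal s - b) i j ^ 2 := by
    set v := s j • e j
    set c := Matrix.toLpLin 2 2 b (e j)
    have hc : U.starProjection c = c := U.starProjection_eq_self_iff.2 ⟨_, rfl⟩
    have h1 : ∑ i, (diagonal s - b) i j ^ 2 = ‖v - c‖ ^ 2 := by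
      rw [EuclideanSpace.real_norm_sq_eq]
      refine Finset.sum_congr rfl fun i _ => ?_
      rcases eq_or_ne i j with rfl | h
      · simp [v, c, e, Matrix.toLpLin_apply]
      · simp [v, c, e, Matrix.toLpLin_apply, h]
    have h2 : Uᗮ.starProjection (v - c) = v - U.starProjection v := by
      rw [Submodule.starProjection_orthogonal_val, map_sub, hc]; abel
    have h3 : ‖v‖ ^ 2 = ‖U.starProjection v‖ ^ 2 + ‖Uᗮ.starProjection v‖ ^ 2 :=
      Submodule.norm_sq_eq_add_norm_sq_starProjection v U
    rw [Submodule.starProjection_orthogonal_val, ← h2] at h3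
    have h4 : ‖Uᗮ.starProjection (v - c)‖ ^ 2 ≤ ‖v - c‖ ^ 2 :=
      pow_le_pow_left₀ (norm_nonneg _) (Uᗮ.norm_starProjection_apply_le _) 2
    have h5 : ‖v‖ ^ 2 = s j ^ 2 := by simp [v, norm_smul]
    have h6 : ‖U.starProjection v‖ ^ 2 = s j ^ 2 * ‖U.starProjection (e j)‖ ^ 2 := by
      simp [v, norm_smul, mul_pow]
    rw [h1]; linarith
  rw [Finset.sum_comm]
  -- The weights `‖P e_i‖ ^ 2`, with `P` the projection onto `U`, lie in `[0, 1]` and sum to `rank b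
  -- ≤ r`.
  refine (sum_filter_le_sum_mul_one_sub r hs (fun i => sq_nonneg (s i))
    (p := fun i => ‖U.starProjection (e i)‖ ^ 2) (fun i => sq_nonneg _)
    (fun i => pow_le_one₀ (norm_nonneg _) (hnorm i)) ?_).trans
    (Finset.sum_le_sum fun j _ => hcol j)
  rw [sum_norm_sq_starProjection, hU]
  exact_mod_cast hb

/-! ### Expected quadratic forms under the joint law -/

theorem continuous_sqNorm_linComb {k : ℕ} (S : Matrix (Fin k) (Fin k) ℝ)
    (L : Matrix (Fin k) (Fin n) ℝ) (M : Matrix (Fin k) (Fin m) ℝ) :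
    Continuous fun p => sqNorm S (linComb L M p) := by
  have h : Continuous (sqNorm S) := by unfold sqNorm; fun_prop
  exact h.comp (linCombCLM L M).continuous

theorem linComb_pair_data {k : ℕ} (G : Matrix (Fin m) (Fin n) ℝ)
    (L : Matrix (Fin k) (Fin n) ℝ) (M : Matrix (Fin k) (Fin m) ℝ)
    (p : EuclideanSpace ℝ (Fin n) × EuclideanSpace ℝ (Fin m)) :
    linComb L M (p.1, act G p.1 + p.2) = linComb (L + M * G) M p := by
  simp only [linComb, act_add, act_act, add_act, add_assoc]

theorem integrable_joint {k : ℕ} (Γpr : Matrix (Fin n) (Fin n) ℝ) (Γobs : Matrix (Fin m) (Fin m) ℝ)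
    (G : Matrix (Fin m) (Fin n) ℝ) (S : Matrix (Fin k) (Fin k) ℝ)
    (L : Matrix (Fin k) (Fin n) ℝ) (M : Matrix (Fin k) (Fin m) ℝ) :
    Integrable (fun p => sqNorm S (linComb L M p)) (joint Γpr Γobs G) := by
  rw [joint_eq_map, integrable_map_measure
    (continuous_sqNorm_linComb S L M).aestronglyMeasurable (measurable_pair_data G).aemeasurable]
  simp only [Function.comp_def, linComb_pair_data]
  exact integrable_sqNorm_linComb _ _ _ _ _

theorem integral_joint {k : ℕ} {Γpr : Matrix (Fin n) (Fin n) ℝ} {Γobs : Matrix (Fin m) (Fin m) ℝ}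
    (hpr : Γpr.PosSemidef) (hobs : Γobs.PosSemidef)
    (G : Matrix (Fin m) (Fin n) ℝ) (S : Matrix (Fin k) (Fin k) ℝ)
    (L : Matrix (Fin k) (Fin n) ℝ) (M : Matrix (Fin k) (Fin m) ℝ) :
    ∫ p, sqNorm S (linComb L M p) ∂(joint Γpr Γobs G) =
      (Sᵀ * ((L + M * G) * Γpr * (L + M * G)ᵀ + M * Γobs * Mᵀ)).trace := by
  rw [joint_eq_map, integral_map (measurable_pair_data G).aemeasurable
    (continuous_sqNorm_linComb S L M).aestronglyMeasurable]
  simp only [linComb_pair_data]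
  exact integral_sqNorm_linComb hpr hobs _ _ _

/-! ### Whitening coordinates and the risk formula -/

/-- `V = W⁻¹` are coordinates in which the prior covariance is the identity and the Hessian is
diagonal. -/
structure IsWhitening (Γpr : Matrix (Fin n) (Fin n) ℝ) (Γobs : Matrix (Fin m) (Fin m) ℝ)
    (G : Matrix (Fin m) (Fin n) ℝ) (W V : Matrix (Fin n) (Fin n) ℝ) (d : Fin n → ℝ) : Prop where
  inv_mul : V * W = 1
  mul_inv : W * V = 1
  prior : Γpr = W * Wᵀ
  hessian : hessian Γobs G = Vᵀ * diagonal d * V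
  nonneg : ∀ i, 0 ≤ d i

theorem IsEigenpairs.isWhitening {Γpr : Matrix (Fin n) (Fin n) ℝ} (hpr : Γpr.PosDef)
    {Γobs : Matrix (Fin m) (Fin m) ℝ} {G : Matrix (Fin m) (Fin n) ℝ}
    {δ : Fin n → ℝ} {w : Fin n → Fin n → ℝ} (h : IsEigenpairs Γpr Γobs G δ w) :
    IsWhitening Γpr Γobs G (Matrix.of w)ᵀ (Matrix.of w * Γpr⁻¹) fun i => δ i ^ 2 := by
  set W := (Matrix.of w)ᵀ
  have hW : Matrix.of w = Wᵀ := rfl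
  have hdet : IsUnit Γpr.det := hpr.det_pos.ne'.isUnit
  have hsym : Γprᵀ = Γpr := hpr.isHermitian
  have h1 : Wᵀ * Γpr⁻¹ * W = 1 := by
    ext i j
    rw [Matrix.mul_assoc, Matrix.one_apply, ← h.orthonormal i j]
    rfl
  -- Orthonormality gives a left inverse of the square matrix `W`; it is also a right inverse, so
  -- the `w i` form a basis.
  have h2 : W * (Wᵀ * Γpr⁻¹) = 1 := mul_eq_one_comm.1 h1
  have h3 : hessian Γobs G * W = Γpr⁻¹ * W * diagonal fun i => δ i ^ 2 := by
    ext i j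
    rw [Matrix.mul_diagonal]
    have := congrFun (h.eigen j) i
    rw [Pi.smul_apply, smul_eq_mul, mul_comm] at this
    exact this
  refine ⟨h1, h2, ?_, ?_, fun i => sq_nonneg _⟩
  · rw [← Matrix.mul_one (W * Wᵀ), ← Matrix.nonsing_inv_mul Γpr hdet, ← Matrix.mul_assoc,
      Matrix.mul_assoc W, h2, Matrix.one_mul]
  · rw [hW, ← Matrix.mul_one (hessian Γobs G), ← h2, ← Matrix.mul_assoc (hessian Γobs G), h3,
      Matrix.transpose_mul, Matrix.transpose_nonsing_inv, hsym, Matrix.transpose_transpose]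

namespace IsWhitening

variable {Γpr : Matrix (Fin n) (Fin n) ℝ} {Γobs : Matrix (Fin m) (Fin m) ℝ}
  {G : Matrix (Fin m) (Fin n) ℝ} {W V : Matrix (Fin n) (Fin n) ℝ} {d : Fin n → ℝ}

theorem transpose_inv_mul (h : IsWhitening Γpr Γobs G W V d) : Wᵀ * Vᵀ = 1 := by
  rw [← Matrix.transpose_mul, h.inv_mul, Matrix.transpose_one]

theorem transpose_mul_inv (h : IsWhitening Γpr Γobs G W V d) : Vᵀ * Wᵀ = 1 := by
  rw [← Matrix.transpose_mul, h.mul_inv, Matrix.transpose_one]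

theorem inv_mul_cancel {k : ℕ} (h : IsWhitening Γpr Γobs G W V d) (X : Matrix (Fin n) (Fin k) ℝ) :
    V * (W * X) = X := by rw [← Matrix.mul_assoc, h.inv_mul, Matrix.one_mul]

theorem mul_inv_cancel {k : ℕ} (h : IsWhitening Γpr Γobs G W V d) (X : Matrix (Fin n) (Fin k) ℝ) :
    W * (V * X) = X := by rw [← Matrix.mul_assoc, h.mul_inv, Matrix.one_mul]

theorem transpose_inv_mul_cancel {k : ℕ} (h : IsWhitening Γpr Γobs G W V d)
    (X : Matrix (Fin n) (Fin k) ℝ) : Wᵀ * (Vᵀ * X) = X := by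
  rw [← Matrix.mul_assoc, h.transpose_inv_mul, Matrix.one_mul]

theorem prior_inv (h : IsWhitening Γpr Γobs G W V d) : Γpr⁻¹ = Vᵀ * V := by
  refine Matrix.inv_eq_right_inv ?_
  rw [h.prior, Matrix.mul_assoc, h.transpose_inv_mul_cancel, h.mul_inv]

theorem hessian_add (h : IsWhitening Γpr Γobs G W V d) :
    BayesLinear.hessian Γobs G + Γpr⁻¹ = Vᵀ * diagonal (fun i => 1 + d i) * V := by
  have : diagonal (fun i => 1 + d i) = diagonal d + (1 : Matrix (Fin n) (Fin n) ℝ) := by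
    rw [← diagonal_one, diagonal_add]
    congr 1; ext i; ring
  rw [this, h.hessian, h.prior_inv, Matrix.mul_add, Matrix.add_mul, Matrix.mul_one]

theorem hessian_add_mul (h : IsWhitening Γpr Γobs G W V d) :
    (Vᵀ * diagonal (fun i => 1 + d i) * V) * (W * diagonal (fun i => (1 + d i)⁻¹) * Wᵀ) = 1 := by
  have : diagonal (fun i => 1 + d i) * diagonal (fun i => (1 + d i)⁻¹) =
      (1 : Matrix (Fin n) (Fin n) ℝ) := by
    rw [diagonal_mul_diagonal, ← diagonal_one]
    congr 1; ext i
    have := h.nonneg i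
    field_simp
  simp only [Matrix.mul_assoc, h.inv_mul_cancel]
  rw [← Matrix.mul_assoc (diagonal _), this, Matrix.one_mul, h.transpose_mul_inv]

theorem postCov_eq (h : IsWhitening Γpr Γobs G W V d) :
    postCov Γpr Γobs G = W * diagonal (fun i => (1 + d i)⁻¹) * Wᵀ := by
  rw [postCov, h.hessian_add, Matrix.inv_eq_right_inv h.hessian_add_mul]

theorem postCov_inv (h : IsWhitening Γpr Γobs G W V d) :
    (postCov Γpr Γobs G)⁻¹ = Vᵀ * diagonal (fun i => 1 + d i) * V := by
  rw [h.postCov_eq, Matrix.inv_eq_left_inv h.hessian_add_mul]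

/-- In whitened coordinates `x` contributes `l + c D`, while the noise enters through `Gᵀ Γobs⁻¹ e`,
whose covariance is `H`; this produces the two squares. -/
theorem integral_joint (h : IsWhitening Γpr Γobs G W V d) (hpr : Γpr.PosDef)
    (hobs : Γobs.PosDef) (l c : Matrix (Fin n) (Fin n) ℝ) {L : Matrix (Fin n) (Fin n) ℝ}
    (hL : L = W * l * V) {M : Matrix (Fin n) (Fin m) ℝ} (hM : M = W * c * Wᵀ * Gᵀ * Γobs⁻¹) :
    ∫ p, sqNorm (postCov Γpr Γobs G)⁻¹ (linComb L M p) ∂(joint Γpr Γobs G) =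
      ∑ i, ∑ j, (1 + d i) * ((l i j + c i j * d j) ^ 2 + c i j ^ 2 * d j) := by
  have hsym : Γobsᵀ = Γobs := hobs.isHermitian
  have hdet : IsUnit Γobs.det := hobs.det_pos.ne'.isUnit
  have hH : Gᵀ * (Γobs⁻¹ * G) = Vᵀ * (diagonal d * V) := by
    have := h.hessian
    rwa [BayesLinear.hessian, Matrix.mul_assoc, Matrix.mul_assoc] at this
  have h1 : L + M * G = W * ((l + c * diagonal d) * V) := by
    rw [hL, hM]
    simp only [Matrix.mul_assoc, hH, h.transpose_inv_mul_cancel, Matrix.add_mul, Matrix.mul_add]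
  have h2 : M * Γobs * Mᵀ = W * (c * diagonal d * cᵀ * Wᵀ) := by
    rw [hM]
    simp only [Matrix.transpose_mul, Matrix.transpose_transpose, Matrix.transpose_nonsing_inv,
      hsym, Matrix.mul_assoc]
    rw [Matrix.nonsing_inv_mul_cancel_left _ _ hdet]
    have hH' (X : Matrix (Fin n) (Fin n) ℝ) :
        Gᵀ * (Γobs⁻¹ * (G * X)) = Vᵀ * (diagonal d * (V * X)) := by
      simpa only [Matrix.mul_assoc] using congrArg (· * X) hH
    simp only [hH', h.transpose_inv_mul_cancel, h.inv_mul_cancel]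
  have h3 : (L + M * G) * Γpr * (L + M * G)ᵀ + M * Γobs * Mᵀ =
      W * ((l + c * diagonal d) * (l + c * diagonal d)ᵀ + c * diagonal d * cᵀ) * Wᵀ := by
    rw [h1, h2, h.prior]
    generalize l + c * diagonal d = a
    simp only [Matrix.mul_add, Matrix.add_mul, Matrix.transpose_mul, Matrix.mul_assoc,
      h.inv_mul_cancel, h.transpose_inv_mul_cancel]
  rw [BayesLinear.integral_joint hpr.posSemidef hobs.posSemidef, h3, h.postCov_inv]
  simp only [Matrix.transpose_mul, Matrix.diagonal_transpose, Matrix.transpose_transpose]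
  rw [← Matrix.mul_assoc, Matrix.trace_mul_comm]
  simp only [Matrix.mul_assoc, h.inv_mul_cancel, h.transpose_inv_mul_cancel]
  rw [Matrix.trace]
  refine Finset.sum_congr rfl fun i _ => ?_
  rw [Matrix.diag_apply, Matrix.diagonal_mul, ← Finset.mul_sum, Matrix.add_apply, Matrix.mul_apply,
    Matrix.mul_apply, ← Finset.sum_add_distrib]
  congr 1
  refine Finset.sum_congr rfl fun j _ => ?_
  simp only [Matrix.transpose_apply, Matrix.add_apply, Matrix.mul_diagonal,
    Matrix.diagonal_mul]
  ring

/-- The gain satisfies the normal equation since `Γ_pos Gᵀ Γobs⁻¹ (G Γpr Gᵀ + Γobs) = Γ_pos (H +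
Γpr⁻¹) Γpr Gᵀ`. -/
theorem postMean_ae_eq (h : IsWhitening Γpr Γobs G W V d) (hpr : Γpr.PosDef)
    (hobs : Γobs.PosDef) :
    ∀ᵐ p ∂(joint Γpr Γobs G), postMean Γpr Γobs G p.2 =
      act (postCov Γpr Γobs G * Gᵀ * Γobs⁻¹) p.2 := by
  refine BayesLinear.postMean_ae_eq hpr.posSemidef hobs.posSemidef G ?_
  have hdet : IsUnit Γobs.det := hobs.det_pos.ne'.isUnit
  have hdet' : IsUnit Γpr.det := hpr.det_pos.ne'.isUnit
  have h1 : postCov Γpr Γobs G * (BayesLinear.hessian Γobs G + Γpr⁻¹) = 1 := by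
    rw [h.hessian_add, h.postCov_eq]
    exact mul_eq_one_comm.1 h.hessian_add_mul
  have h2 : postCov Γpr Γobs G * Gᵀ * Γobs⁻¹ * (G * Γpr * Gᵀ + Γobs) =
      postCov Γpr Γobs G * (BayesLinear.hessian Γobs G + Γpr⁻¹) * (Γpr * Gᵀ) := by
    simp only [BayesLinear.hessian, Matrix.mul_add, Matrix.add_mul, Matrix.mul_assoc,
      Matrix.nonsing_inv_mul _ hdet, Matrix.mul_one, Matrix.nonsing_inv_mul_cancel_left _ _ hdet']
  rw [h2, h1, Matrix.one_mul]

end IsWhitening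

theorem loss_act_eq (Γpr : Matrix (Fin n) (Fin n) ℝ) (Γobs : Matrix (Fin m) (Fin m) ℝ)
    (G : Matrix (Fin m) (Fin n) ℝ) (A : Matrix (Fin n) (Fin m) ℝ) :
    loss Γpr Γobs G (act A) =
      fun p => sqNorm (postCov Γpr Γobs G)⁻¹ (linComb (-1) A p) := by
  ext p
  have : act (-1 : Matrix (Fin n) (Fin n) ℝ) p.1 = -p.1 := by ext; simp [act, Matrix.neg_mulVec]
  rw [loss, linComb, this, sub_eq_neg_add]

theorem act_sub_act_eq (A K : Matrix (Fin n) (Fin m) ℝ)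
    (p : EuclideanSpace ℝ (Fin n) × EuclideanSpace ℝ (Fin m)) :
    act A p.2 - act K p.2 = linComb (0 : Matrix (Fin n) (Fin n) ℝ) (A - K) p := by
  have : act (0 : Matrix (Fin n) (Fin n) ℝ) p.1 = 0 := by ext; simp [act]
  rw [linComb, sub_act, this, zero_add]

namespace IsWhitening

variable {Γpr : Matrix (Fin n) (Fin n) ℝ} {Γobs : Matrix (Fin m) (Fin m) ℝ}
  {G : Matrix (Fin m) (Fin n) ℝ} {W V : Matrix (Fin n) (Fin n) ℝ} {d : Fin n → ℝ}

theorem bayesRisk_eq (h : IsWhitening Γpr Γobs G W V d) (hpr : Γpr.PosDef) (hobs : Γobs.PosDef)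
    (c : Matrix (Fin n) (Fin n) ℝ) :
    bayesRisk Γpr Γobs G (act (W * c * Wᵀ * Gᵀ * Γobs⁻¹)) =
      (∑ i, ∑ j, (1 + d i) * ((1 + d j) * d j) *
        (c - diagonal fun k => (1 + d k)⁻¹) i j ^ 2) + n := by
  have hL : (-1 : Matrix (Fin n) (Fin n) ℝ) = W * (-1) * V := by simp [h.mul_inv]
  rw [bayesRisk, loss_act_eq, h.integral_joint hpr hobs (-1) c hL rfl]
  -- Spreading `n` over the diagonal reduces the claim to one identity per entry. On the diagonal it
  -- is `(1 + d) * ((c * d - 1) ^ 2 + c ^ 2 * d) = (1 + d) ^ 2 * d * (c - (1 + d)⁻¹) ^ 2 + 1`.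
  have hn : (n : ℝ) = ∑ i : Fin n, ∑ j : Fin n, (1 : Matrix (Fin n) (Fin n) ℝ) i j := by
    simp [Matrix.one_apply]
  rw [hn, ← Finset.sum_add_distrib]
  refine Finset.sum_congr rfl fun i _ => ?_
  rw [← Finset.sum_add_distrib]
  refine Finset.sum_congr rfl fun j _ => ?_
  rcases eq_or_ne i j with rfl | hij
  · have := h.nonneg i
    simp only [Matrix.neg_apply, Matrix.sub_apply, Matrix.one_apply_eq, diagonal_apply_eq]
    field_simp
    ring
  · simp only [Matrix.neg_apply, Matrix.sub_apply, Matrix.one_apply_ne hij,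
      diagonal_apply_ne _ hij]
    ring

theorem integral_sub_postMean (h : IsWhitening Γpr Γobs G W V d) (hpr : Γpr.PosDef)
    (hobs : Γobs.PosDef) (c : Matrix (Fin n) (Fin n) ℝ) :
    ∫ p, sqNorm (postCov Γpr Γobs G)⁻¹
        (act (W * c * Wᵀ * Gᵀ * Γobs⁻¹) p.2 - postMean Γpr Γobs G p.2) ∂(joint Γpr Γobs G) =
      ∑ i, ∑ j, (1 + d i) * ((1 + d j) * d j) *
        (c - diagonal fun k => (1 + d k)⁻¹) i j ^ 2 := by
  have hae : (fun p => sqNorm (postCov Γpr Γobs G)⁻¹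
        (act (W * c * Wᵀ * Gᵀ * Γobs⁻¹) p.2 - postMean Γpr Γobs G p.2)) =ᵐ[joint Γpr Γobs G]
      fun p => sqNorm (postCov Γpr Γobs G)⁻¹ (linComb 0
        (W * c * Wᵀ * Gᵀ * Γobs⁻¹ - postCov Γpr Γobs G * Gᵀ * Γobs⁻¹) p) := by
    filter_upwards [h.postMean_ae_eq hpr hobs] with p hp
    rw [hp, act_sub_act_eq]
  rw [integral_congr_ae hae, h.integral_joint hpr hobs 0 (c - diagonal fun k => (1 + d k)⁻¹)
    (by simp) (by simp only [h.postCov_eq, Matrix.mul_sub, Matrix.sub_mul])]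
  refine Finset.sum_congr rfl fun i _ => Finset.sum_congr rfl fun j _ => ?_
  rw [Matrix.zero_apply]
  ring

theorem integral_postMean_sub (h : IsWhitening Γpr Γobs G W V d) (hpr : Γpr.PosDef)
    (hobs : Γobs.PosDef) :
    ∫ p, sqNorm (postCov Γpr Γobs G)⁻¹ (postMean Γpr Γobs G p.2 - p.1) ∂(joint Γpr Γobs G) = n := by
  -- With `c = (1 + D)⁻¹` the estimator is the posterior mean itself, and the excess risk vanishes.
  have hr := h.bayesRisk_eq hpr hobs (diagonal fun k => (1 + d k)⁻¹)
  rw [← h.postCov_eq] at hr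
  simp only [sub_self, Matrix.zero_apply, ne_eq, OfNat.ofNat_ne_zero, not_false_eq_true, zero_pow,
    mul_zero, Finset.sum_const_zero, zero_add] at hr
  rw [← hr, bayesRisk]
  refine integral_congr_ae ?_
  filter_upwards [h.postMean_ae_eq hpr hobs] with p hp
  rw [hp, loss]

theorem integrable_sub_postMean (h : IsWhitening Γpr Γobs G W V d) (hpr : Γpr.PosDef)
    (hobs : Γobs.PosDef) (A : Matrix (Fin n) (Fin m) ℝ) :
    Integrable (fun p => sqNorm (postCov Γpr Γobs G)⁻¹ (act A p.2 - postMean Γpr Γobs G p.2))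
      (joint Γpr Γobs G) := by
  refine (integrable_joint Γpr Γobs G (postCov Γpr Γobs G)⁻¹ 0
    (A - postCov Γpr Γobs G * Gᵀ * Γobs⁻¹)).congr ?_
  filter_upwards [h.postMean_ae_eq hpr hobs] with p hp
  rw [hp, act_sub_act_eq]

theorem integrable_postMean_sub (h : IsWhitening Γpr Γobs G W V d) (hpr : Γpr.PosDef)
    (hobs : Γobs.PosDef) :
    Integrable (fun p => sqNorm (postCov Γpr Γobs G)⁻¹ (postMean Γpr Γobs G p.2 - p.1))
      (joint Γpr Γobs G) := by
  have hi := integrable_joint Γpr Γobs G (postCov Γpr Γobs G)⁻¹ (-1)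
    (postCov Γpr Γobs G * Gᵀ * Γobs⁻¹)
  rw [← loss_act_eq] at hi
  refine hi.congr ?_
  filter_upwards [h.postMean_ae_eq hpr hobs] with p hp
  rw [hp, loss]

/-- Expresses the approximation class through `c = 1 - b`, where `b = V B Vᵀ` has rank at most that
of `B`. -/
theorem prior_sub_eq (h : IsWhitening Γpr Γobs G W V d) (B : Matrix (Fin n) (Fin n) ℝ) :
    Γpr - B = W * (1 - V * B * Vᵀ) * Wᵀ := by
  simp only [Matrix.mul_sub, Matrix.sub_mul, Matrix.mul_one, Matrix.mul_assoc, h.mul_inv_cancel,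
    h.transpose_mul_inv, ← h.prior]

end IsWhitening

/-! ### Optimization over the rank-constrained class -/

/-- The excess Bayes risk of `(Γpr - W b Wᵀ) Gᵀ Γobs⁻¹` is at least the tail sum of `δ ^ 6` when
`b` has rank at most `r`. -/
theorem sum_filter_pow_six_le {r : ℕ} {δ : Fin n → ℝ} (hδ : Antitone fun i => δ i ^ 2)
    {b : Matrix (Fin n) (Fin n) ℝ} (hb : b.rank ≤ r) :
    ∑ i with r ≤ i.val, δ i ^ 6 ≤
      ∑ i, ∑ j, (1 + δ i ^ 2) * ((1 + δ j ^ 2) * δ j ^ 2) *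
        (1 - b - diagonal fun k => (1 + δ k ^ 2)⁻¹ : Matrix (Fin n) (Fin n) ℝ) i j ^ 2 := by
  set f : Fin n → ℝ := fun i => √(1 + δ i ^ 2)
  have hf (i) : f i ^ 2 = 1 + δ i ^ 2 := Real.sq_sqrt (by positivity)
  -- The scaling splits the weights into row and column factors. It sends `1 - (1 + D)⁻¹ = D (1 +
  -- D)⁻¹` to `diag (δ ^ 3)` and does not increase the rank of `b`.
  set b' := diagonal f * b * diagonal fun j => f j * δ j
  have hb' : b'.rank ≤ r :=
    ((rank_mul_le_left _ _).trans (rank_mul_le_right _ _)).trans hb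
  have key := sum_sq_le_sum_sq_diagonal_sub (s := fun i => δ i ^ 3)
    (fun i j hij => by
      have := pow_le_pow_left₀ (sq_nonneg _) (hδ hij) 3
      simp only [← pow_mul] at this ⊢
      exact this) hb'
  simp only [← pow_mul] at key
  refine key.trans_eq (Finset.sum_congr rfl fun i _ => Finset.sum_congr rfl fun j _ => ?_)
  simp only [b', Matrix.sub_apply, Matrix.mul_diagonal, Matrix.diagonal_mul]
  rcases eq_or_ne i j with rfl | hij
  · simp only [diagonal_apply_eq, Matrix.one_apply_eq]
    have h1 : δ i ^ 3 - f i * b i i * (f i * δ i) =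
        (1 + δ i ^ 2) * δ i * (1 - b i i - (1 + δ i ^ 2)⁻¹) := by
      have : f i * b i i * (f i * δ i) = f i ^ 2 * b i i * δ i := by ring
      rw [this, hf]
      have : 1 + δ i ^ 2 ≠ 0 := by positivity
      field_simp
      ring
    rw [h1]; ring
  · simp only [diagonal_apply_ne _ hij, Matrix.one_apply_ne hij]
    rw [← hf, ← hf]; ring

theorem optCov_eq_sub_mul (Γpr : Matrix (Fin n) (Fin n) ℝ) (δ : Fin n → ℝ) (w : Fin n → Fin n → ℝ)
    (r : ℕ) : optCov Γpr δ w r = Γpr - (Matrix.of w)ᵀ *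
      diagonal (fun i : Fin n => if i.val < r then δ i ^ 2 * (1 + δ i ^ 2)⁻¹ else 0) *
        (Matrix.of w)ᵀᵀ := by
  rw [optCov, sub_right_inj]
  ext a b
  rw [Matrix.sum_apply, Finset.sum_filter, Matrix.mul_apply]
  refine Finset.sum_congr rfl fun i _ => ?_
  rw [Matrix.mul_diagonal]
  split_ifs
  · simp [vecMulVec_apply]; ring
  · simp

theorem rank_diagonal_ite_le (r : ℕ) (a : Fin n → ℝ) :
    (diagonal fun i : Fin n => if i.val < r then a i else 0).rank ≤ r := by
  rw [Matrix.rank_diagonal, Fintype.card_subtype]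
  calc _ ≤ (Finset.range r).card :=
        Finset.card_le_card_of_injOn Fin.val (fun i hi => by
          by_contra hr
          simp_all) Fin.val_injective.injOn
    _ = r := Finset.card_range r

/-- Diagonal entries below index `r` cancel exactly; each later one is `δ ^ 2 / (1 + δ ^ 2)`, and
its weight `(1 + δ ^ 2) ^ 2 * δ ^ 2` turns the square into `δ ^ 6`. -/
theorem sum_optimal_eq (r : ℕ) (δ : Fin n → ℝ) :
    ∑ i, ∑ j, (1 + δ i ^ 2) * ((1 + δ j ^ 2) * δ j ^ 2) *
      (1 - diagonal (fun i : Fin n => if i.val < r then δ i ^ 2 * (1 + δ i ^ 2)⁻¹ else 0) -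
        diagonal fun k => (1 + δ k ^ 2)⁻¹ : Matrix (Fin n) (Fin n) ℝ) i j ^ 2 =
    ∑ i with r ≤ i.val, δ i ^ 6 := by
  rw [Finset.sum_filter]
  refine Finset.sum_congr rfl fun i _ => ?_
  rw [Finset.sum_eq_single i]
  · simp only [Matrix.sub_apply, Matrix.one_apply_eq, diagonal_apply_eq]
    have : 1 + δ i ^ 2 ≠ 0 := by positivity
    rcases lt_or_ge i.val r with h | h
    · rw [if_pos h, if_neg (not_le.2 h)]
      field_simp
      ring
    · rw [if_neg (not_lt.2 h), if_pos h]
      field_simp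
      ring
  · intro j _ hij
    simp only [Matrix.sub_apply, Matrix.one_apply_ne hij.symm, diagonal_apply_ne _ hij.symm]
    ring
  · simp

theorem IsEigenpairs.optCov_mem_covClass {Γpr : Matrix (Fin n) (Fin n) ℝ} (hpr : Γpr.PosDef)
    {Γobs : Matrix (Fin m) (Fin m) ℝ} {G : Matrix (Fin m) (Fin n) ℝ}
    {δ : Fin n → ℝ} {w : Fin n → Fin n → ℝ} (h : IsEigenpairs Γpr Γobs G δ w) (r : ℕ) :
    optCov Γpr δ w r ∈ covClass Γpr r := by
  have hw := h.isWhitening hpr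
  rw [optCov_eq_sub_mul]
  set W := (Matrix.of w)ᵀ
  set g : Fin n → ℝ := fun i => if i.val < r then δ i ^ 2 * (1 + δ i ^ 2)⁻¹ else 0
  have hg0 (i) : 0 ≤ g i := by
    simp only [g]; split_ifs <;> positivity
  have hg1 (i) : g i < 1 := by
    simp only [g]; split_ifs
    · rw [← div_eq_mul_inv, div_lt_one (by positivity)]; linarith
    · exact one_pos
  constructor
  · have : Γpr - W * diagonal g * Wᵀ = W * diagonal (fun i => 1 - g i) * Wᴴ := by
      have h1 : diagonal (fun i => 1 - g i) = 1 - diagonal g := by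
        rw [← diagonal_one, diagonal_sub]
      rw [h1, Matrix.mul_sub, Matrix.sub_mul, Matrix.mul_one, conjTranspose_eq_transpose_of_trivial,
        ← hw.prior]
    rw [this]
    refine (PosDef.diagonal fun i => sub_pos.2 (hg1 i)).mul_mul_conjTranspose_same ?_
    rw [Matrix.vecMul_injective_iff_isUnit]
    exact IsUnit.of_mul_eq_one _ hw.mul_inv
  -- The factor `K = W diag (√g)` satisfies `K Kᵀ = W diag (g) Wᵀ`.
  · refine ⟨n, W * diagonal fun i => √(g i), ?_, ?_⟩
    · refine (rank_mul_le_right _ _).trans ?_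
      have : (fun i => √(g i)) =
          fun i : Fin n => if i.val < r then √(δ i ^ 2 * (1 + δ i ^ 2)⁻¹) else 0 := by
        ext i; simp only [g]; split_ifs <;> simp
      rw [this]
      exact rank_diagonal_ite_le r _
    · rw [Matrix.transpose_mul, diagonal_transpose, ← Matrix.mul_assoc,
        Matrix.mul_assoc W (diagonal fun i => √(g i)), diagonal_mul_diagonal]
      simp only [Real.mul_self_sqrt (hg0 _)]

end BayesLinear

end

/-! ### The main theorem -/

theorem theorem4p2 {n m : ℕ}
    (Γpr : Matrix (Fin n) (Fin n) ℝ) (hpr : Γpr.PosDef)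
    (Γobs : Matrix (Fin m) (Fin m) ℝ) (hobs : Γobs.PosDef)
    (G : Matrix (Fin m) (Fin n) ℝ) (r : ℕ)
    (δ : Fin n → ℝ) (w : Fin n → Fin n → ℝ)
    (hδw : BayesLinear.IsEigenpairs Γpr Γobs G δ w)
    (Γhat : Matrix (Fin n) (Fin n) ℝ) (hΓhat : Γhat = BayesLinear.optCov Γpr δ w r)
    (Ahat : Matrix (Fin n) (Fin m) ℝ) (hAhat : Ahat = Γhat * Gᵀ * Γobs⁻¹) :
    -- all expectations below are finite
    (∀ A : Matrix (Fin n) (Fin m) ℝ,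
      Integrable (BayesLinear.loss Γpr Γobs G (BayesLinear.act A))
        (BayesLinear.joint Γpr Γobs G)) ∧
    Integrable (fun p => BayesLinear.sqNorm (BayesLinear.postCov Γpr Γobs G)⁻¹
        (BayesLinear.act Ahat p.2 - BayesLinear.postMean Γpr Γobs G p.2))
      (BayesLinear.joint Γpr Γobs G) ∧
    Integrable (fun p => BayesLinear.sqNorm (BayesLinear.postCov Γpr Γobs G)⁻¹
        (BayesLinear.postMean Γpr Γobs G p.2 - p.1))
      (BayesLinear.joint Γpr Γobs G) ∧
    Γhat ∈ BayesLinear.covClass Γpr r ∧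
    -- (i)
    Ahat ∈ BayesLinear.meanClass Γpr Γobs G r ∧
    IsMinOn (fun A => BayesLinear.bayesRisk Γpr Γobs G (BayesLinear.act A))
      (BayesLinear.meanClass Γpr Γobs G r) Ahat ∧
    -- (ii)
    BayesLinear.bayesRisk Γpr Γobs G (BayesLinear.act Ahat) =
      (∫ p, BayesLinear.sqNorm (BayesLinear.postCov Γpr Γobs G)⁻¹
          (BayesLinear.act Ahat p.2 - BayesLinear.postMean Γpr Γobs G p.2)
        ∂(BayesLinear.joint Γpr Γobs G)) +
      (∫ p, BayesLinear.sqNorm (BayesLinear.postCov Γpr Γobs G)⁻¹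
          (BayesLinear.postMean Γpr Γobs G p.2 - p.1)
        ∂(BayesLinear.joint Γpr Γobs G)) ∧
    BayesLinear.bayesRisk Γpr Γobs G (BayesLinear.act Ahat) =
      (∑ i : Fin n with r ≤ i.val, δ i ^ 6) + n := by
  have h := hδw.isWhitening hpr
  have hmem := hδw.optCov_mem_covClass hpr r
  have hrank := BayesLinear.rank_diagonal_ite_le r fun i => δ i ^ 2 * (1 + δ i ^ 2)⁻¹
  have hsum := BayesLinear.sum_optimal_eq r δ
  have hopt := BayesLinear.optCov_eq_sub_mul Γpr δ w r
  rw [← hΓhat] at hmem hopt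
  set W := (Matrix.of w)ᵀ
  set b : Matrix (Fin n) (Fin n) ℝ :=
    diagonal fun i : Fin n => if i.val < r then δ i ^ 2 * (1 + δ i ^ 2)⁻¹ else 0
  have hA : Ahat = W * (1 - b) * Wᵀ * Gᵀ * Γobs⁻¹ := by
    rw [hAhat, hopt, Matrix.mul_sub, Matrix.sub_mul _ _ Wᵀ, Matrix.mul_one, ← h.prior]
  have hrisk : BayesLinear.bayesRisk Γpr Γobs G (BayesLinear.act Ahat) =
      (∑ i : Fin n with r ≤ i.val, δ i ^ 6) + n := by
    rw [hA, h.bayesRisk_eq hpr hobs, hsum]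
  refine ⟨fun A => ?_, h.integrable_sub_postMean hpr hobs Ahat, h.integrable_postMean_sub hpr hobs,
    hmem, ⟨W * b * Wᵀ, ?_, by rw [hAhat, hopt]⟩, ?_, ?_, hrisk⟩
  · rw [BayesLinear.loss_act_eq]
    exact BayesLinear.integrable_joint _ _ _ _ _ _
  · exact ((rank_mul_le_left _ _).trans (rank_mul_le_right _ _)).trans hrank
  · rintro A ⟨B, hB, rfl⟩
    change BayesLinear.bayesRisk Γpr Γobs G (BayesLinear.act Ahat) ≤
      BayesLinear.bayesRisk Γpr Γobs G (BayesLinear.act _)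
    -- Both risks contain the same constant `n`, so only the excess risks are compared.
    rw [hrisk, h.prior_sub_eq B, h.bayesRisk_eq hpr hobs]
    gcongr
    exact BayesLinear.sum_filter_pow_six_le (fun i j hij => hδw.antitone i j hij)
      (((rank_mul_le_left _ _).trans (rank_mul_le_right _ _)).trans hB)
  · rw [hrisk, h.integral_postMean_sub hpr hobs, hA, h.integral_sub_postMean hpr hobs, hsum]
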